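/- **Setting.** Let $H$ be a real Hilbert space (of finite or infinite dimension), $\phi:\mathbb{R}^{d_1}\to H$ a feature map, $\mathcal K(u,v)=\langle\phi(u),\phi(v)\rangle$ its kernel, and $z_1,\dots,z_p:\mathbb{R}^{d_0}\to\mathbb{R}^{d_1}$ the patch maps. A matrix with $p$ columns in $H$ is a $p$-tuple of vectors of $H$; for two such matrices $B=[b_1,\dots,b_p]$, $C=[c_1,\dots,c_q]$ write $B^\top C=(\langle b_a,c_b\rangle)_{a,b}\in\mathbb{R}^{p\times q}$. The singular values of $C$ are the square roots of the eigenvalues of $C^\top C$; $\|C\|_*$ is their sum and $\sigma_{\max}(C)$ the largest of them ($0$ if $C$ has no columns). Put $\Phi(\mathbf x)=[\phi(z_1(\mathbf x)),\dots,\phi(z_p(\mathbf x))]$ and $K(\mathbf x,\mathbf x')=\big(\mathcal K(z_a(\mathbf x),z_b(\mathbf x'))\big)_{a,b=1}^p$. Let $\mathbf x_1,\dots,\mathbf x_n\in\mathbb{R}^{d_0}$, $y_1,\dots,y_n\in\mathbb{R}$, $c>0$, and let $\ell:\mathbb{R}\to\mathbb{R}$ be convex and non-increasing, with Fenchel conjugate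 $\ell^*(t)=\sup_{\xi}(t\xi-\ell(\xi))\in(-\infty,\infty]$. Let $\hat A$ be an optimum of the primal problem $$\min_{A,\xi}\ \|A\|_*+c\sum_{i=1}^n\ell(\xi_i)\quad\text{subject to}\quad y_i\operatorname{Tr}(\Phi(\mathbf x_i)^\top A)\ge\xi_i,\ i=1,\dots,n,$$ and let $\hat\alpha$ be an optimum of the dual problem $$\max_{\alpha}\ -c\sum_{i=1}^n\ell^*(-\alpha_i/c)\quad\text{subject to}\quad \lambda_{\max}\Big(\sum_{i,j}\alpha_i\alpha_jy_iy_jK(\mathbf x_i,\mathbf x_j)\Big)\le1,\quad \alpha_i\ge0,\ i=1,\dots,n.$$ Let $S=\sum_{i,j}\hat\alpha_i\hat\alpha_jy_iy_jK(\mathbf x_i,\mathbf x_j)\in\mathbb{R}^{p\times p}$. Let $\hat A=\hat U_1\hat D_1\hat V_1^\top$ be any compact SVD ($\hat U_1$ has $r$ orthonormal columns in $H$, $\hat V_1\in\mathbb{R}^{p\times r}$ has orthonormal columns, $\hat D_1$ is diagonal with positive diagonal; $r=\operatorname{rank}\hat A$), let $\hat V_2$ be such that $[\hat V_1\mid\hat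 V_2]$ is an orthogonal $p\times p$ matrix, and let $\hat U_2$ be an isometry onto the orthogonal complement of the column space of $\hat U_1$. **Theorem.** 1. There is exactly one matrix $\hat E$ with $p-r$ columns such that $\sum_i\hat\alpha_iy_i\Phi(\mathbf x_i)=\hat U_1\hat V_1^\top+\hat U_2\hat E\hat V_2^\top$. It satisfies $\sigma_{\max}(\hat E)\le1$ and $S=\hat V_1\hat V_1^\top+\hat V_2\hat E^\top\hat E\hat V_2^\top$; in particular $S\hat V_1=\hat V_1$. 2. Suppose moreover that $\sigma_{\max}(\hat E)<1$. Then the eigenspace of $S$ for the eigenvalue $1$ is the column space of $\hat V_1$, and $\hat V_1$ is recovered by the eigenvectors of $S$ with eigenvalue $1$ in the following sense. For every eigendecomposition $S=\tilde V\Lambda\tilde V^{-1}$ with $\tilde V\in\mathbb{R}^{p\times p}$ invertible and $\Lambda=\operatorname{diag}(\lambda_1,\dots,\lambda_p)$, exactly $r$ of the $\lambda_i$ are equal to $1$, and, in whatever order they are taken, the columns $\tilde V(i)$ with $\lambda_i=1$ form a matrix $[\tilde V(i)]_{\lambda_i=1}=\hat V_1Q$ with $Q\in\mathbb{R}^{r\times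 r}$ invertible; if $\tilde V$ is orthogonal, so is $Q$. Moreover, there is an eigendecomposition with orthogonal $\tilde V$ for which, in a suitable order, $[\tilde V(i)]_{\lambda_i=1}=\hat V_1$ exactly. -/

import Mathlib

open scoped Matrix InnerProductSpace

noncomputable section

/-! ### Matrices with columns in a Hilbert space

A real `d₂ × p` matrix, where `d₂` may be infinite, is a family of `p` columns in a real Hilbert
space `H` of dimension `d₂`, that is, a function `Fin p → H`. -/

section Columns

variable {H : Type*} [NormedAddCommGroup H] [InnerProductSpace ℝ H] {p q : ℕ}

/-- The product `Bᵀ C`: the real matrix of inner products of the columns of `B` and of `C`. -/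
def transposeMul (B : Fin p → H) (C : Fin q → H) : Matrix (Fin p) (Fin q) ℝ :=
  Matrix.of fun a b => ⟪B a, C b⟫_ℝ

/-- The product `B M` of a matrix with columns in `H` and a real matrix. -/
def colMul (B : Fin p → H) (M : Matrix (Fin p) (Fin q) ℝ) : Fin q → H :=
  fun b => ∑ a, M a b • B a

theorem transposeMul_self_isHermitian (C : Fin p → H) : (transposeMul C C).IsHermitian := by
  ext a b
  simp [transposeMul, real_inner_comm]

/-- The singular values of `C` (with multiplicity, `p` of them, zeros included): the square roots
of the eigenvalues of `Cᵀ C`. -/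
def singVal (C : Fin p → H) (k : Fin p) : ℝ :=
  Real.sqrt ((transposeMul_self_isHermitian C).eigenvalues k)

/-- The nuclear norm `‖C‖_*`: the sum of the singular values. -/
def nuclearNorm (C : Fin p → H) : ℝ := ∑ k, singVal C k

/-- The largest singular value `σ_max(C)` (zero for a matrix without columns). -/
def sigmaMax (C : Fin p → H) : ℝ := ⨆ k, singVal C k

/-- `A = U₁ D₁ V₁ᵀ` is a compact singular value decomposition, with `D₁ = diag(d)`: the columns of
`U₁` and of `V₁` are orthonormal and the `r` diagonal entries of `D₁` are positive
(so that `r = rank A`). -/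
structure IsCompactSVD {r : ℕ} (A : Fin p → H) (U₁ : Fin r → H) (d : Fin r → ℝ)
    (V₁ : Matrix (Fin p) (Fin r) ℝ) : Prop where
  orthonormal_left : transposeMul U₁ U₁ = 1
  orthonormal_right : V₁ᵀ * V₁ = 1
  pos : ∀ k, 0 < d k
  eq : A = colMul U₁ (Matrix.diagonal d * V₁ᵀ)

/-- The square matrix `[V₁ | V₂]` is orthogonal. -/
def IsOrthogonalCompletion {r s : ℕ} (V₁ : Matrix (Fin p) (Fin r) ℝ)
    (V₂ : Matrix (Fin p) (Fin s) ℝ) : Prop :=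
  (Matrix.fromCols V₁ V₂)ᵀ * Matrix.fromCols V₁ V₂ = 1 ∧
    Matrix.fromCols V₁ V₂ * (Matrix.fromCols V₁ V₂)ᵀ = 1

/-- The product `U₂ E`, where the columns of `U₂` are an orthonormal basis of the orthogonal
complement of the column space of `U₁`. The matrix `E` is given without coordinates, by its columns
as vectors of that complement, so that `U₂` is the inclusion into `H`. -/
def complMul {r s : ℕ} (U₁ : Fin r → H) (E : Fin s → (Submodule.span ℝ (Set.range U₁))ᗮ) :
    Fin s → H :=
  fun k => (E k : H)

end Columns

/-- The largest (real) eigenvalue of a square matrix (zero for the empty matrix). -/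
def lambdaMax {p : ℕ} (M : Matrix (Fin p) (Fin p) ℝ) : ℝ :=
  sSup {μ : ℝ | Module.End.HasEigenvalue (Matrix.toLin' M) μ}

/-- The Fenchel conjugate `ℓ*(t) = sup_ξ (t ξ - ℓ(ξ))`, with values in the extended reals. -/
def fenchelConj (ℓ : ℝ → ℝ) (t : ℝ) : EReal := ⨆ ξ : ℝ, ((t * ξ - ℓ ξ : ℝ) : EReal)

/-! ### The convexified two-layer CNN -/

section CCNN

variable {H : Type*} [NormedAddCommGroup H] [InnerProductSpace ℝ H] {d₀ d₁ p n : ℕ}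

/-- The kernel function `𝒦(u, v) = φ(u)ᵀ φ(v)`. -/
def kernelFun (φ : (Fin d₁ → ℝ) → H) (u v : Fin d₁ → ℝ) : ℝ := ⟪φ u, φ v⟫_ℝ

/-- The basis function matrix `Φ(x) = [φ(z₁(x)), …, φ(z_p(x))]`; here `z a x` is the `a`-th patch
of `x`. -/
def featureMatrix (φ : (Fin d₁ → ℝ) → H) (z : Fin p → (Fin d₀ → ℝ) → (Fin d₁ → ℝ))
    (x : Fin d₀ → ℝ) : Fin p → H :=
  fun a => φ (z a x)

/-- The kernel generating matrix `K(x, x')`, with entries `𝒦(z_a(x), z_b(x'))`. -/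
def kernelMatrix (φ : (Fin d₁ → ℝ) → H) (z : Fin p → (Fin d₀ → ℝ) → (Fin d₁ → ℝ))
    (x x' : Fin d₀ → ℝ) : Matrix (Fin p) (Fin p) ℝ :=
  Matrix.of fun a b => kernelFun φ (z a x) (z b x')

/-- `∑ᵢ ∑ⱼ αᵢ αⱼ yᵢ yⱼ K(xᵢ, xⱼ)`. -/
def dualMatrix (φ : (Fin d₁ → ℝ) → H) (z : Fin p → (Fin d₀ → ℝ) → (Fin d₁ → ℝ))
    (x : Fin n → Fin d₀ → ℝ) (y : Fin n → ℝ) (α : Fin n → ℝ) : Matrix (Fin p) (Fin p) ℝ :=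
  ∑ i, ∑ j, (α i * α j * y i * y j) • kernelMatrix φ z (x i) (x j)

/-- Feasibility in the primal problem: `yᵢ Tr(Φ(xᵢ)ᵀ A) ≥ ξᵢ` for all `i`. -/
def PrimalFeasible (φ : (Fin d₁ → ℝ) → H) (z : Fin p → (Fin d₀ → ℝ) → (Fin d₁ → ℝ))
    (x : Fin n → Fin d₀ → ℝ) (y : Fin n → ℝ) (A : Fin p → H) (ξ : Fin n → ℝ) : Prop :=
  ∀ i, ξ i ≤ y i * (transposeMul (featureMatrix φ z (x i)) A).trace

/-- The primal objective `‖A‖_* + c ∑ᵢ ℓ(ξᵢ)`. -/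
def primalObj (ℓ : ℝ → ℝ) (c : ℝ) (A : Fin p → H) (ξ : Fin n → ℝ) : ℝ :=
  nuclearNorm A + c * ∑ i, ℓ (ξ i)

/-- `A` is an optimum of the primal problem (together with some `ξ`). -/
def IsPrimalOptimal (φ : (Fin d₁ → ℝ) → H) (z : Fin p → (Fin d₀ → ℝ) → (Fin d₁ → ℝ))
    (x : Fin n → Fin d₀ → ℝ) (y : Fin n → ℝ) (ℓ : ℝ → ℝ) (c : ℝ) (A : Fin p → H) : Prop :=
  ∃ ξ : Fin n → ℝ, PrimalFeasible φ z x y A ξ ∧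
    ∀ (B : Fin p → H) (η : Fin n → ℝ), PrimalFeasible φ z x y B η →
      primalObj ℓ c A ξ ≤ primalObj ℓ c B η

/-- Feasibility in the dual problem. -/
def DualFeasible (φ : (Fin d₁ → ℝ) → H) (z : Fin p → (Fin d₀ → ℝ) → (Fin d₁ → ℝ))
    (x : Fin n → Fin d₀ → ℝ) (y : Fin n → ℝ) (α : Fin n → ℝ) : Prop :=
  lambdaMax (dualMatrix φ z x y α) ≤ 1 ∧ ∀ i, 0 ≤ α i

/-- The dual objective `-c ∑ᵢ ℓ*(-αᵢ / c)`. -/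
def dualObj (ℓ : ℝ → ℝ) (c : ℝ) (α : Fin n → ℝ) : EReal :=
  -((c : EReal) * ∑ i, fenchelConj ℓ (-(α i / c)))

/-- `α` is an optimum of the dual problem. -/
def IsDualOptimal (φ : (Fin d₁ → ℝ) → H) (z : Fin p → (Fin d₀ → ℝ) → (Fin d₁ → ℝ))
    (x : Fin n → Fin d₀ → ℝ) (y : Fin n → ℝ) (ℓ : ℝ → ℝ) (c : ℝ) (α : Fin n → ℝ) : Prop :=
  DualFeasible φ z x y α ∧
    ∀ β : Fin n → ℝ, DualFeasible φ z x y β → dualObj ℓ c β ≤ dualObj ℓ c α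

end CCNN

end

/-! ### Algebra of columns in `H`; spectral and nuclear norms -/

section ColumnAlgebra

variable {H : Type*} [NormedAddCommGroup H] [InnerProductSpace ℝ H] {p q m : ℕ}

/-! Put `M = ∑ αᵢ yᵢ Φ(xᵢ)`. Then `S = Mᵀ M`, so the dual eigenvalue constraint says exactly that
`M` is a contraction. Any contraction satisfies `Tr(Mᵀ A) ≤ ‖A‖_*`; optimality forces equality.
Indeed, strong duality (`exists_dual_certificate`, a separation in `ℝⁿ × ℝ`, so that `dim H` plays
no role) leaves no duality gap, and complementary slackness is `nuclearNorm_le_trace_of_optimal`.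

Written in the singular vectors of `A`, equality reads `∑ d_k ⟪M v_k, u_k⟫ = ∑ d_k` with each inner
product at most `1` and `d_k > 0`. Hence `M v_k = u_k` by the equality case of Cauchy–Schwarz
(`IsContraction.colMul_right_eq_left`). A contraction that preserves the length of the `v_k` must
send their orthogonal complement into that of the `u_k` (`IsContraction.transposeMul_eq_zero`),
which is the block form with `E = M V₂`.

The Gram matrix of `M` is then the identity on the range of `V₁` and `Eᵀ E` on its complement. If
`σ_max(E) < 1`, the second block does not have the eigenvalue `1`, so the fixed space of `S` is the
range of `V₁`; the rest is linear algebra on bases of that space. -/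

theorem transposeMul_colMul_right (B : Fin p → H) (C : Fin q → H) {l : ℕ}
    (Q : Matrix (Fin q) (Fin l) ℝ) :
    transposeMul B (colMul C Q) = transposeMul B C * Q := by
  ext a b
  simp [transposeMul, colMul, inner_sum, inner_smul_right, Matrix.mul_apply, mul_comm]

theorem transposeMul_colMul_left (B : Fin p → H) (C : Fin q → H) {l : ℕ}
    (P : Matrix (Fin p) (Fin l) ℝ) :
    transposeMul (colMul B P) C = Pᵀ * transposeMul B C := by
  ext a b
  simp [transposeMul, colMul, sum_inner, inner_smul_left, Matrix.mul_apply]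

theorem transposeMul_colMul (B : Fin p → H) (C : Fin q → H) {k l : ℕ}
    (P : Matrix (Fin p) (Fin k) ℝ) (Q : Matrix (Fin q) (Fin l) ℝ) :
    transposeMul (colMul B P) (colMul C Q) = Pᵀ * transposeMul B C * Q := by
  rw [transposeMul_colMul_left, transposeMul_colMul_right, Matrix.mul_assoc]

theorem colMul_colMul (B : Fin p → H) {k l : ℕ} (P : Matrix (Fin p) (Fin k) ℝ)
    (Q : Matrix (Fin k) (Fin l) ℝ) : colMul (colMul B P) Q = colMul B (P * Q) := by
  ext b
  simp only [colMul, Matrix.mul_apply, Finset.smul_sum, Finset.sum_smul, smul_smul]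
  rw [Finset.sum_comm]
  exact Finset.sum_congr rfl fun j _ => Finset.sum_congr rfl fun i _ => by rw [mul_comm]

theorem colMul_one (B : Fin p → H) : colMul B 1 = B := by
  ext b
  simp [colMul, Matrix.one_apply]

theorem colMul_zero (B : Fin p → H) : colMul B (0 : Matrix (Fin p) (Fin q) ℝ) = 0 := by
  ext b
  simp [colMul]

theorem colMul_add (B : Fin p → H) (P Q : Matrix (Fin p) (Fin q) ℝ) :
    colMul B (P + Q) = colMul B P + colMul B Q := by
  ext b
  simp [colMul, add_smul, Finset.sum_add_distrib]

theorem add_colMul (B C : Fin p → H) (P : Matrix (Fin p) (Fin q) ℝ) :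
    colMul (B + C) P = colMul B P + colMul C P := by
  ext b
  simp [colMul, smul_add, Finset.sum_add_distrib]

theorem transposeMul_add_right (B : Fin p → H) (C D : Fin q → H) :
    transposeMul B (C + D) = transposeMul B C + transposeMul B D := by
  ext a b
  simp [transposeMul, inner_add_right]

theorem transposeMul_add_left (B C : Fin p → H) (D : Fin q → H) :
    transposeMul (B + C) D = transposeMul B D + transposeMul C D := by
  ext a b
  simp [transposeMul, inner_add_left]

theorem transposeMul_smul_right (t : ℝ) (B : Fin p → H) (C : Fin q → H) :
    transposeMul B (t • C) = t • transposeMul B C := by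
  ext a b
  simp [transposeMul, inner_smul_right]

theorem transposeMul_smul_left (t : ℝ) (B : Fin p → H) (C : Fin q → H) :
    transposeMul (t • B) C = t • transposeMul B C := by
  ext a b
  simp [transposeMul, inner_smul_left]

theorem transposeMul_sum_left {ι : Type*} (s : Finset ι) (B : ι → Fin p → H) (C : Fin q → H) :
    transposeMul (∑ i ∈ s, B i) C = ∑ i ∈ s, transposeMul (B i) C := by
  ext a b
  simp [transposeMul, sum_inner, Matrix.sum_apply]

theorem transposeMul_sum_right {ι : Type*} (s : Finset ι) (B : Fin p → H) (C : ι → Fin q → H) :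
    transposeMul B (∑ i ∈ s, C i) = ∑ i ∈ s, transposeMul B (C i) := by
  ext a b
  simp [transposeMul, inner_sum, Matrix.sum_apply]

theorem transpose_transposeMul (B : Fin p → H) (C : Fin q → H) :
    (transposeMul B C)ᵀ = transposeMul C B := by
  ext a b
  simp [transposeMul, real_inner_comm]

/-- The product `C v` of a matrix with columns in `H` and a real vector. -/
def colMulVec (C : Fin p → H) (v : Fin p → ℝ) : H := ∑ a, v a • C a

theorem inner_colMulVec (B : Fin p → H) (C : Fin q → H) (v : Fin p → ℝ) (w : Fin q → ℝ) :
    ⟪colMulVec B v, colMulVec C w⟫_ℝ = v ⬝ᵥ (transposeMul B C *ᵥ w) := by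
  simp only [colMulVec, sum_inner, inner_sum, inner_smul_left, inner_smul_right, dotProduct,
    Matrix.mulVec, transposeMul, Matrix.of_apply, Finset.mul_sum]
  rw [Finset.sum_comm]
  refine Finset.sum_congr rfl fun j _ => Finset.sum_congr rfl fun i _ => ?_
  simp only [RCLike.conj_to_real]
  ring

theorem colMulVec_add (B : Fin p → H) (v w : Fin p → ℝ) :
    colMulVec B (v + w) = colMulVec B v + colMulVec B w := by
  simp [colMulVec, add_smul, Finset.sum_add_distrib]

theorem colMulVec_smul (B : Fin p → H) (t : ℝ) (v : Fin p → ℝ) :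
    colMulVec B (t • v) = t • colMulVec B v := by
  simp [colMulVec, smul_smul, Finset.smul_sum]

theorem colMulVec_colMul (B : Fin p → H) (P : Matrix (Fin p) (Fin q) ℝ) (v : Fin q → ℝ) :
    colMulVec (colMul B P) v = colMulVec B (P *ᵥ v) := by
  simp only [colMul, colMulVec, Matrix.mulVec, dotProduct, Finset.smul_sum, Finset.sum_smul,
    smul_smul]
  rw [Finset.sum_comm]
  exact Finset.sum_congr rfl fun j _ => Finset.sum_congr rfl fun i _ => by rw [mul_comm]

theorem colMul_apply (B : Fin p → H) (P : Matrix (Fin p) (Fin q) ℝ) (k : Fin q) :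
    colMul B P k = colMulVec B (P.col k) := rfl

theorem norm_sq_colMulVec (B : Fin p → H) (v : Fin p → ℝ) :
    ‖colMulVec B v‖ ^ 2 = v ⬝ᵥ (transposeMul B B *ᵥ v) := by
  rw [← inner_colMulVec, real_inner_self_eq_norm_sq]

/-- `σ_max(M) ≤ 1`, stated through the action of `M` on vectors. -/
def IsContraction (M : Fin p → H) : Prop := ∀ v, ‖colMulVec M v‖ ^ 2 ≤ v ⬝ᵥ v

theorem dotProduct_mulVec_self {W : Matrix (Fin p) (Fin q) ℝ} (hW : Wᵀ * W = 1)
    (v : Fin q → ℝ) : (W *ᵥ v) ⬝ᵥ (W *ᵥ v) = v ⬝ᵥ v := by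
  rw [Matrix.dotProduct_mulVec, Matrix.vecMul_mulVec, hW, Matrix.vecMul_one]

theorem IsContraction.colMul {M : Fin p → H} (hM : IsContraction M)
    {W : Matrix (Fin p) (Fin q) ℝ} (hW : Wᵀ * W = 1) : IsContraction (colMul M W) := fun v => by
  rw [colMulVec_colMul, ← dotProduct_mulVec_self hW v]
  exact hM _

theorem IsContraction.norm_apply_le {M : Fin p → H} (hM : IsContraction M) (k : Fin p) :
    ‖M k‖ ≤ 1 := by
  have h := hM (Pi.single k 1)
  have h2 : colMulVec M (Pi.single k 1) = M k := by
    simp [colMulVec, Pi.single_apply]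
  rw [h2] at h
  simp at h
  exact h

/-- Diagonalization of a real symmetric matrix by an orthogonal matrix. -/
theorem exists_orthogonal_diagonalization {T : Matrix (Fin p) (Fin p) ℝ} (hT : T.IsHermitian) :
    ∃ W : Matrix (Fin p) (Fin p) ℝ, Wᵀ * W = 1 ∧ W * Wᵀ = 1 ∧
      T = W * Matrix.diagonal hT.eigenvalues * Wᵀ := by
  have h := hT.spectral_theorem
  rw [Unitary.conjStarAlgAut_apply] at h
  refine ⟨hT.eigenvectorUnitary, ?_, ?_, ?_⟩
  · simpa [Matrix.star_eq_conjTranspose, Matrix.conjTranspose_eq_transpose_of_trivial] using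
      Unitary.coe_star_mul_self hT.eigenvectorUnitary
  · simpa [Matrix.star_eq_conjTranspose, Matrix.conjTranspose_eq_transpose_of_trivial] using
      Unitary.coe_mul_star_self hT.eigenvectorUnitary
  · simpa [Matrix.star_eq_conjTranspose, Matrix.conjTranspose_eq_transpose_of_trivial,
      Function.comp_def] using h

theorem singVal_nonneg (C : Fin p → H) (k : Fin p) : 0 ≤ singVal C k := Real.sqrt_nonneg _

/-- The right singular vectors of `C` form an orthogonal matrix. -/
theorem exists_right_singular_vectors (C : Fin p → H) :
    ∃ W : Matrix (Fin p) (Fin p) ℝ, Wᵀ * W = 1 ∧ W * Wᵀ = 1 ∧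
      transposeMul C C = W * Matrix.diagonal (fun k => singVal C k ^ 2) * Wᵀ ∧
      ∀ k, ‖colMulVec C (W.col k)‖ = singVal C k := by
  obtain ⟨W, h1, h2, h3⟩ := exists_orthogonal_diagonalization (transposeMul_self_isHermitian C)
  have key : ∀ k, ‖colMulVec C (W.col k)‖ ^ 2 =
      (transposeMul_self_isHermitian C).eigenvalues k := fun k => by
    have h4 : transposeMul (colMul C W) (colMul C W) =
        Matrix.diagonal (transposeMul_self_isHermitian C).eigenvalues := by
      rw [transposeMul_colMul]
      conv_lhs => rw [h3]
      calc Wᵀ * (W * Matrix.diagonal (transposeMul_self_isHermitian C).eigenvalues * Wᵀ) * W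
          = (Wᵀ * W) * Matrix.diagonal (transposeMul_self_isHermitian C).eigenvalues *
            (Wᵀ * W) := by simp only [Matrix.mul_assoc]
        _ = _ := by rw [h1, Matrix.one_mul, Matrix.mul_one]
    have h5 := congrFun (congrFun h4 k) k
    rw [Matrix.diagonal_apply_eq, transposeMul, Matrix.of_apply, real_inner_self_eq_norm_sq] at h5
    exact h5
  have key2 : ∀ k, singVal C k ^ 2 = (transposeMul_self_isHermitian C).eigenvalues k := fun k =>
    Real.sq_sqrt (by rw [← key k]; positivity)
  refine ⟨W, h1, h2, ?_, fun k => ?_⟩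
  · simp only [key2]; exact h3
  · rw [singVal, ← key k, Real.sqrt_sq (norm_nonneg _)]

theorem dotProduct_conj_diagonal_mulVec (W : Matrix (Fin p) (Fin q) ℝ) (δ : Fin q → ℝ)
    (v : Fin p → ℝ) : v ⬝ᵥ ((W * Matrix.diagonal δ * Wᵀ) *ᵥ v) = ∑ k, δ k * (Wᵀ *ᵥ v) k ^ 2 := by
  rw [← Matrix.mulVec_mulVec, ← Matrix.mulVec_mulVec, Matrix.dotProduct_mulVec,
    ← Matrix.mulVec_transpose, dotProduct]
  refine Finset.sum_congr rfl fun k _ => ?_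
  rw [Matrix.mulVec_diagonal]
  ring

theorem isContraction_of_conj_diagonal {M : Fin p → H} {W : Matrix (Fin p) (Fin p) ℝ}
    (hW : W * Wᵀ = 1) {δ : Fin p → ℝ} (hδ : ∀ k, δ k ≤ 1)
    (h : transposeMul M M = W * Matrix.diagonal δ * Wᵀ) : IsContraction M := fun v => by
  have hW' : (Wᵀ)ᵀ * Wᵀ = 1 := by rwa [Matrix.transpose_transpose]
  rw [norm_sq_colMulVec, h, dotProduct_conj_diagonal_mulVec, ← dotProduct_mulVec_self hW' v,
    dotProduct]
  refine Finset.sum_le_sum fun k _ => ?_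
  nlinarith [hδ k, sq_nonneg ((Wᵀ *ᵥ v) k)]

/-- Duality between the spectral and the nuclear norm. -/
theorem IsContraction.trace_le_nuclearNorm {M : Fin p → H} (hM : IsContraction M)
    (A : Fin p → H) : (transposeMul M A).trace ≤ nuclearNorm A := by
  obtain ⟨W, h1, h2, -, h4⟩ := exists_right_singular_vectors A
  -- The trace pairing is invariant under a common right rotation, so it can be computed in the
  -- right singular basis of `A`.
  have e : (transposeMul M A).trace =
      (transposeMul (_root_.colMul M W) (_root_.colMul A W)).trace := by
    rw [transposeMul_colMul, Matrix.trace_mul_comm, ← Matrix.mul_assoc, h2, Matrix.one_mul]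
  rw [e, nuclearNorm, Matrix.trace]
  refine Finset.sum_le_sum fun k _ => ?_
  rw [Matrix.diag_apply, transposeMul, Matrix.of_apply]
  refine (real_inner_le_norm _ _).trans ?_
  rw [← h4 k, ← colMul_apply]
  nlinarith [(hM.colMul h1).norm_apply_le k, norm_nonneg (_root_.colMul A W k)]

/-- The witness is the polar factor `A (AᵀA)^(-1/2)`. Since `0⁻¹ = 0`, the null directions of `A`
are sent to zero and need no separate treatment. With the preceding bound this exhibits the nuclear
norm as a maximum of linear functionals, whence its sublinearity. -/
theorem exists_isContraction_trace_eq_nuclearNorm (A : Fin p → H) :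
    ∃ M : Fin p → H, IsContraction M ∧ (transposeMul M A).trace = nuclearNorm A := by
  obtain ⟨W, h1, h2, h3, -⟩ := exists_right_singular_vectors A
  refine ⟨colMul A (W * Matrix.diagonal (fun k => (singVal A k)⁻¹) * Wᵀ), ?_, ?_⟩
  · refine isContraction_of_conj_diagonal h2
      (δ := fun k => (singVal A k)⁻¹ * singVal A k ^ 2 * (singVal A k)⁻¹) (fun k => ?_) ?_
    · by_cases h : singVal A k = 0
      · simp [h]
      · apply le_of_eq; field_simp
    · rw [transposeMul_colMul, h3]
      simp only [Matrix.transpose_mul, Matrix.transpose_transpose, Matrix.diagonal_transpose]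
      rw [← Matrix.diagonal_mul_diagonal, ← Matrix.diagonal_mul_diagonal]
      have hl : ∀ X : Matrix (Fin p) (Fin p) ℝ, Wᵀ * (W * X) = X := fun X => by
        rw [← Matrix.mul_assoc, h1, Matrix.one_mul]
      simp only [Matrix.mul_assoc, hl]
  · rw [transposeMul_colMul_left, h3]
    simp only [Matrix.transpose_mul, Matrix.transpose_transpose, Matrix.diagonal_transpose]
    have hl : ∀ X : Matrix (Fin p) (Fin p) ℝ, Wᵀ * (W * X) = X := fun X => by
      rw [← Matrix.mul_assoc, h1, Matrix.one_mul]
    simp only [Matrix.mul_assoc, hl]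
    rw [Matrix.trace_mul_comm, Matrix.mul_assoc, Matrix.mul_assoc, h1, Matrix.mul_one,
      Matrix.diagonal_mul_diagonal, Matrix.trace_diagonal, nuclearNorm]
    refine Finset.sum_congr rfl fun k _ => ?_
    by_cases h : singVal A k = 0
    · simp [h]
    · field_simp

theorem nuclearNorm_nonneg (A : Fin p → H) : 0 ≤ nuclearNorm A :=
  Finset.sum_nonneg fun k _ => singVal_nonneg A k

theorem nuclearNorm_add_le (A B : Fin p → H) :
    nuclearNorm (A + B) ≤ nuclearNorm A + nuclearNorm B := by
  obtain ⟨M, hM, h⟩ := exists_isContraction_trace_eq_nuclearNorm (A + B)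
  rw [← h, transposeMul_add_right, Matrix.trace_add]
  exact add_le_add (hM.trace_le_nuclearNorm A) (hM.trace_le_nuclearNorm B)

theorem nuclearNorm_smul_le {t : ℝ} (ht : 0 ≤ t) (A : Fin p → H) :
    nuclearNorm (t • A) ≤ t * nuclearNorm A := by
  obtain ⟨M, hM, h⟩ := exists_isContraction_trace_eq_nuclearNorm (t • A)
  rw [← h, transposeMul_smul_right, Matrix.trace_smul, smul_eq_mul]
  exact mul_le_mul_of_nonneg_left (hM.trace_le_nuclearNorm A) ht

theorem trace_transposeMul_rankOne (M : Fin p → H) (w : H) (v : Fin p → ℝ) :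
    (transposeMul M (fun a => v a • w)).trace = ⟪colMulVec M v, w⟫_ℝ := by
  simp [Matrix.trace, transposeMul, colMulVec, sum_inner, inner_smul_left, inner_smul_right]

/-- The unit ball of the spectral norm is the polar of that of the nuclear norm. -/
theorem isContraction_of_trace_le_nuclearNorm {M : Fin p → H}
    (h : ∀ B : Fin p → H, (transposeMul M B).trace ≤ nuclearNorm B) : IsContraction M := by
  intro v
  set w := colMulVec M v
  -- Testing on the rank-one matrix `w vᵀ` with `w = M v` makes the trace equal to `‖w‖²`. Its
  -- nuclear norm need not be computed: it is attained at some contraction `N`, giving `‖w‖² ≤ ⟪N v,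
  -- w⟫`.
  have h1 := h (fun a => v a • w)
  rw [trace_transposeMul_rankOne, real_inner_self_eq_norm_sq] at h1
  obtain ⟨N, hN, h2⟩ := exists_isContraction_trace_eq_nuclearNorm (fun a => v a • w)
  rw [← h2, trace_transposeMul_rankOne] at h1
  have h3 := real_inner_le_norm (colMulVec N v) w
  have h4 : ‖w‖ * ‖w‖ ≤ ‖colMulVec N v‖ * ‖w‖ := by nlinarith
  refine le_trans ?_ (hN v)
  rcases (norm_nonneg w).eq_or_lt with h0 | h0
  · rw [← h0, zero_pow two_ne_zero]; positivity
  · have := le_of_mul_le_mul_right h4 h0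
    gcongr

/-- A matrix is a contraction iff the largest eigenvalue of its Gram matrix is at most one. -/
theorem lambdaMax_transposeMul_self_le_one_iff (M : Fin p → H) :
    lambdaMax (transposeMul M M) ≤ 1 ↔ IsContraction M := by
  constructor
  · intro h
    obtain ⟨W, h1, h2, h3⟩ := exists_orthogonal_diagonalization (transposeMul_self_isHermitian M)
    refine isContraction_of_conj_diagonal h2 (fun k => le_trans ?_ h) h3
    refine le_csSup (Module.End.finite_hasEigenvalue _).bddAbove ?_
    refine Module.End.hasEigenvalue_of_hasEigenvector
      (x := ⇑((transposeMul_self_isHermitian M).eigenvectorBasis k)) ⟨?_, ?_⟩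
    · rw [Module.End.mem_eigenspace_iff, Matrix.toLin'_apply]
      exact (transposeMul_self_isHermitian M).mulVec_eigenvectorBasis k
    · intro h0
      exact (transposeMul_self_isHermitian M).eigenvectorBasis.orthonormal.ne_zero k
        (by ext i; exact congrFun h0 i)
  · intro h
    -- The nonnegativity of the bound covers an empty set of eigenvalues, where the supremum is `0`.
    refine Real.sSup_le (fun μ hμ => ?_) zero_le_one
    obtain ⟨v, hv⟩ := hμ.exists_hasEigenvector
    have h1 := h v
    have h2 := hv.apply_eq_smul
    rw [Matrix.toLin'_apply] at h2
    rw [norm_sq_colMulVec, h2, dotProduct_smul, smul_eq_mul] at h1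
    have h3 : 0 < v ⬝ᵥ v := (Ne.symm (dotProduct_self_eq_zero.not.2 hv.2)).lt_of_le
      (Finset.sum_nonneg fun i _ => mul_self_nonneg (v i))
    nlinarith

end ColumnAlgebra

/-! ### Convex duality and the extended-real dual objective -/

section Duality

/-- Fenchel–Rockafellar duality for `N + g ∘ L` with values of `L` in `ℝⁿ`: existence of a dual
certificate. -/
theorem exists_dual_certificate {E : Type*} [AddCommGroup E] [Module ℝ E] {n : ℕ}
    {N : E → ℝ} (hN : ConvexOn ℝ Set.univ N) (L : E →ₗ[ℝ] (Fin n → ℝ))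
    {g : (Fin n → ℝ) → ℝ} (hg : ConvexOn ℝ Set.univ g) (hgc : Continuous g) {v : ℝ}
    (hv : ∀ B, v ≤ N B + g (L B)) :
    ∃ a : Fin n → ℝ, ∀ u B, v ≤ g u + a ⬝ᵥ u + (N B - a ⬝ᵥ L B) := by
  -- The strict epigraph of `g` is separated from the set of points lying below `v - N B` over `L
  -- B`; `hv` says that they are disjoint.
  have hP : Convex ℝ {w : (Fin n → ℝ) × ℝ | g w.1 < w.2} := by
    simpa using hg.convex_strict_epigraph
  have hPo : IsOpen {w : (Fin n → ℝ) × ℝ | g w.1 < w.2} :=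
    isOpen_lt (hgc.comp continuous_fst) continuous_snd
  have hQ : Convex ℝ {w : (Fin n → ℝ) × ℝ | ∃ B, w.1 = L B ∧ w.2 ≤ v - N B} := by
    rintro ⟨u₁, t₁⟩ ⟨B₁, h₁, h₁'⟩ ⟨u₂, t₂⟩ ⟨B₂, h₂, h₂'⟩ a b ha hb hab
    refine ⟨a • B₁ + b • B₂, ?_, ?_⟩
    · simp only at h₁ h₂
      simp [h₁, h₂]
    · have := hN.2 (Set.mem_univ B₁) (Set.mem_univ B₂) ha hb hab
      simp only [smul_eq_mul] at this h₁' h₂' ⊢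
      have e : v = a * v + b * v := by rw [← add_mul, hab, one_mul]
      simp only [Prod.smul_mk, Prod.mk_add_mk, smul_eq_mul]
      nlinarith [mul_le_mul_of_nonneg_left h₁' ha, mul_le_mul_of_nonneg_left h₂' hb]
  obtain ⟨f, τ, hf₁, hf₂⟩ := geometric_hahn_banach_open hP hPo hQ (by
    rw [Set.disjoint_left]
    rintro ⟨u, t⟩ h₁ ⟨B, h₂, h₃⟩
    simp only [Set.mem_ofPred_eq] at h₁ h₂ h₃
    rw [h₂] at h₁
    linarith [hv B])
  set b := f (0, 1) with hb
  have hf : ∀ u t, f (u, t) = (fun i => f (Pi.single i 1, 0)) ⬝ᵥ u + t * b := by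
    intro u t
    have h₁ : ((u, t) : (Fin n → ℝ) × ℝ) = ∑ i, u i • (Pi.single i 1, 0) + t • (0, 1) := by
      ext j
      · simp [Prod.fst_sum, Finset.sum_apply, Pi.single_apply]
      · simp [Prod.snd_sum]
    rw [h₁, map_add, map_sum, map_smul]
    simp only [map_smul, smul_eq_mul, dotProduct, mul_comm, hb]
  -- The separating hyperplane is not vertical: over `0`, the maximum supplies a point of the
  -- epigraph strictly above a point of the other set.
  have hb0 : b < 0 := by
    have h₁ := hf₁ (0, max (g 0) (v - N 0) + 1)
      (by rw [Set.mem_ofPred_eq]; exact (le_max_left _ _).trans_lt (lt_add_one _))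
    have h₂ := hf₂ (0, v - N 0) ⟨0, by simp, le_rfl⟩
    rw [hf] at h₁ h₂
    have h₃ := le_max_right (g 0) (v - N 0)
    by_contra! h
    nlinarith
  refine ⟨fun i => f (Pi.single i 1, 0) / b, fun u B => ?_⟩
  have hdot : ∀ w : Fin n → ℝ, (fun i => f (Pi.single i 1, 0) / b) ⬝ᵥ w =
      ((fun i => f (Pi.single i 1, 0)) ⬝ᵥ w) / b := fun w => by
    simp only [dotProduct, Finset.sum_div]
    exact Finset.sum_congr rfl fun i _ => by ring
  have h₂ := hf₂ (L B, v - N B) ⟨B, rfl, le_rfl⟩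
  rw [hf] at h₂
  rw [hdot, hdot]
  -- The epigraph is strict, so `(u, g u)` is approached from above.
  refine le_of_forall_pos_le_add fun ε hε => ?_
  have h₁ := hf₁ (u, g u + ε) (lt_add_of_pos_right _ hε)
  rw [hf] at h₁
  have h₃ := h₁.trans_le h₂
  set s := (fun i => f (Pi.single i 1, 0)) ⬝ᵥ u
  set s' := (fun i => f (Pi.single i 1, 0)) ⬝ᵥ L B
  have h₄ : s = s / b * b := (div_mul_cancel₀ _ hb0.ne).symm
  have h₅ : s' = s' / b * b := (div_mul_cancel₀ _ hb0.ne).symm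
  by_contra! h
  rw [h₄, h₅] at h₃
  nlinarith

/-- Extracts the dual constraints from the certificate by letting its test points run along rays. -/
theorem nonneg_of_forall_le_mul {C s : ℝ} (h : ∀ t : ℝ, 0 ≤ t → C ≤ t * s) : 0 ≤ s := by
  by_contra! hs
  have h0 := h 0 le_rfl
  have h1 := h ((C - 1) / s) (div_nonneg_of_nonpos (by linarith) hs.le)
  rw [div_mul_cancel₀ _ hs.ne] at h1
  linarith

theorem coe_sum_ereal {ι : Type*} (s : Finset ι) (f : ι → ℝ) :
    ((∑ i ∈ s, f i : ℝ) : EReal) = ∑ i ∈ s, (f i : EReal) :=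
  map_sum (⟨⟨Real.toEReal, EReal.coe_zero⟩, EReal.coe_add⟩ : ℝ →+ EReal) f s

/-- The coordinates vary independently, so the suprema may be approached simultaneously. Freezing
all but one coordinate at `0` shows that each supremum is finite, which moves the argument to `ℝ`.
-/
theorem sum_iSup_coe_le {n : ℕ} (f : Fin n → ℝ → ℝ) {K : ℝ}
    (h : ∀ u : Fin n → ℝ, ∑ i, f i (u i) ≤ K) :
    ∑ i, (⨆ ξ, ((f i ξ : ℝ) : EReal)) ≤ (K : EReal) := by
  have hb : ∀ i, BddAbove (Set.range (f i)) := fun i => by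
    refine ⟨K - ∑ j ∈ Finset.univ.erase i, f j 0, ?_⟩
    rintro _ ⟨ξ, rfl⟩
    have h₁ := h (Function.update 0 i ξ)
    rw [← Finset.add_sum_erase _ _ (Finset.mem_univ i), Function.update_self,
      Finset.sum_congr rfl (g := fun j => f j 0) fun j hj => by
        rw [Function.update_of_ne (Finset.ne_of_mem_erase hj)]; rfl] at h₁
    linarith
  have hs : ∑ i, (⨆ ξ, f i ξ) ≤ K := by
    refine le_of_forall_pos_le_add fun ε hε => ?_
    -- Dividing by `n + 1` rather than `n` also covers `n = 0`.
    have hδ : 0 < ε / (n + 1) := by positivity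
    choose u hu using fun i => exists_lt_of_lt_ciSup (sub_lt_self (⨆ ξ, f i ξ) hδ)
    have h₁ : ∑ i, ((⨆ ξ, f i ξ) - ε / (n + 1)) ≤ ∑ i, f i (u i) :=
      Finset.sum_le_sum fun i _ => (hu i).le
    rw [Finset.sum_sub_distrib, Finset.sum_const, Finset.card_univ, Fintype.card_fin,
      nsmul_eq_mul] at h₁
    have h₂ : (n : ℝ) * (ε / (n + 1)) ≤ ε := by
      rw [← mul_div_assoc, div_le_iff₀ (by positivity)]
      nlinarith
    linarith [h u]
  calc ∑ i, (⨆ ξ, ((f i ξ : ℝ) : EReal))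
      ≤ ∑ i, ((⨆ ξ, f i ξ : ℝ) : EReal) := Finset.sum_le_sum fun i _ =>
        iSup_le fun ξ => EReal.coe_le_coe_iff.2 (le_ciSup (hb i) ξ)
    _ = ((∑ i, (⨆ ξ, f i ξ) : ℝ) : EReal) := by
        rw [← coe_sum_ereal]
    _ ≤ K := EReal.coe_le_coe_iff.2 hs

/-- Together with its converse below, this replaces the extended-real dual objective by a family of
real inequalities, one for each `u`. -/
theorem coe_le_dualObj {n : ℕ} {ℓ : ℝ → ℝ} {c : ℝ} (hc : 0 < c) {α : Fin n → ℝ} {v : ℝ}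
    (h : ∀ u : Fin n → ℝ, v ≤ c * ∑ i, ℓ (u i) + α ⬝ᵥ u) : (v : EReal) ≤ dualObj ℓ c α := by
  have h₁ := sum_iSup_coe_le (K := -v / c) (fun i ξ => -(α i / c) * ξ - ℓ ξ) fun u => by
    have e : ∑ i, (-(α i / c) * u i - ℓ (u i)) = -(c * ∑ i, ℓ (u i) + α ⬝ᵥ u) / c := by
      rw [Finset.sum_sub_distrib, neg_add, add_div, neg_div, mul_div_cancel_left₀ _ hc.ne',
        dotProduct, neg_div, Finset.sum_div, add_comm, sub_eq_add_neg]
      congr 1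
      rw [← Finset.sum_neg_distrib]
      exact Finset.sum_congr rfl fun i _ => by rw [neg_mul, div_mul_eq_mul_div]
    rw [e]
    exact div_le_div_of_nonneg_right (neg_le_neg (h u)) hc.le
  have h₂ := mul_le_mul_of_nonneg_left h₁ (EReal.coe_nonneg.2 hc.le)
  rw [← EReal.coe_mul, mul_div_cancel₀ _ hc.ne', EReal.coe_neg] at h₂
  exact EReal.le_neg.2 h₂

theorem le_of_coe_le_dualObj {n : ℕ} {ℓ : ℝ → ℝ} {c : ℝ} (hc : 0 < c) {α : Fin n → ℝ} {v : ℝ}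
    (h : (v : EReal) ≤ dualObj ℓ c α) (u : Fin n → ℝ) : v ≤ c * ∑ i, ℓ (u i) + α ⬝ᵥ u := by
  have h₁ := EReal.le_neg.1 h
  have h₂ : ((∑ i, (-(α i / c) * u i - ℓ (u i)) : ℝ) : EReal) ≤
      ∑ i, fenchelConj ℓ (-(α i / c)) := by
    rw [coe_sum_ereal]
    exact Finset.sum_le_sum fun i _ =>
      le_iSup (fun ξ : ℝ => ((-(α i / c) * ξ - ℓ ξ : ℝ) : EReal)) (u i)
  have h₃ := (mul_le_mul_of_nonneg_left h₂ (EReal.coe_nonneg.2 hc.le)).trans h₁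
  rw [← EReal.coe_mul, ← EReal.coe_neg, EReal.coe_le_coe_iff, Finset.sum_sub_distrib, mul_sub,
    Finset.mul_sum] at h₃
  have e : ∑ i, c * (-(α i / c) * u i) = -(α ⬝ᵥ u) := by
    rw [dotProduct, ← Finset.sum_neg_distrib]
    refine Finset.sum_congr rfl fun i _ => ?_
    field_simp
  rw [e] at h₃
  linarith

end Duality

/-! ### Strong duality and complementary slackness for the CCNN problems -/

section OptimalityConditions

variable {H : Type*} [NormedAddCommGroup H] [InnerProductSpace ℝ H] {d₀ d₁ p n : ℕ}

theorem convexOn_nuclearNorm : ConvexOn ℝ Set.univ (nuclearNorm : (Fin p → H) → ℝ) :=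
  ⟨convex_univ, fun A _ B _ _ _ ha hb _ => (nuclearNorm_add_le _ _).trans
    (add_le_add (nuclearNorm_smul_le ha A) (nuclearNorm_smul_le hb B))⟩

/-- The linear map `A ↦ (yᵢ Tr(Φᵢᵀ A))ᵢ`. -/
def marginMap (Φ : Fin n → Fin p → H) (y : Fin n → ℝ) : (Fin p → H) →ₗ[ℝ] (Fin n → ℝ) where
  toFun A i := y i * (transposeMul (Φ i) A).trace
  map_add' A B := by
    ext i
    simp [transposeMul_add_right, mul_add]
  map_smul' t A := by
    ext i
    simp [transposeMul_smul_right]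
    ring

theorem dotProduct_marginMap (Φ : Fin n → Fin p → H) (y α : Fin n → ℝ) (A : Fin p → H) :
    α ⬝ᵥ marginMap Φ y A = (transposeMul (∑ i, (α i * y i) • Φ i) A).trace := by
  rw [transposeMul_sum_left, Matrix.trace_sum]
  simp [dotProduct, marginMap, transposeMul_smul_left, mul_assoc]

theorem dualMatrix_eq_transposeMul (φ : (Fin d₁ → ℝ) → H)
    (z : Fin p → (Fin d₀ → ℝ) → (Fin d₁ → ℝ)) (x : Fin n → Fin d₀ → ℝ) (y α : Fin n → ℝ) :
    dualMatrix φ z x y α = transposeMul (∑ i, (α i * y i) • featureMatrix φ z (x i))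
      (∑ i, (α i * y i) • featureMatrix φ z (x i)) := by
  rw [transposeMul_sum_left]
  refine Finset.sum_congr rfl fun i _ => ?_
  rw [transposeMul_sum_right]
  refine Finset.sum_congr rfl fun j _ => ?_
  rw [transposeMul_smul_right, transposeMul_smul_left, smul_smul]
  congr 1
  ring

theorem convexOn_sum_loss {ℓ : ℝ → ℝ} (hconv : ConvexOn ℝ Set.univ ℓ) {c : ℝ} (hc : 0 < c) :
    ConvexOn ℝ Set.univ fun u : Fin n → ℝ => c * ∑ i, ℓ (u i) := by
  refine ⟨convex_univ, fun u _ w _ a b ha hb hab => ?_⟩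
  simp only [smul_eq_mul, Pi.add_apply, Pi.smul_apply]
  have h : ∑ i, ℓ (a * u i + b * w i) ≤ ∑ i, (a * ℓ (u i) + b * ℓ (w i)) :=
    Finset.sum_le_sum fun i _ => hconv.2 (Set.mem_univ _) (Set.mem_univ _) ha hb hab
  rw [Finset.sum_add_distrib, ← Finset.mul_sum, ← Finset.mul_sum] at h
  nlinarith

/-- Strong duality: a lower bound of the primal problem is attained in the dual problem. -/
theorem exists_dualFeasible_coe_le_dualObj (φ : (Fin d₁ → ℝ) → H)
    (z : Fin p → (Fin d₀ → ℝ) → (Fin d₁ → ℝ)) (x : Fin n → Fin d₀ → ℝ) (y : Fin n → ℝ)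
    {ℓ : ℝ → ℝ} (hconv : ConvexOn ℝ Set.univ ℓ) (hmono : Antitone ℓ) {c : ℝ} (hc : 0 < c)
    {v : ℝ} (hv : ∀ B η, PrimalFeasible φ z x y B η → v ≤ primalObj ℓ c B η) :
    ∃ α : Fin n → ℝ, DualFeasible φ z x y α ∧ (v : EReal) ≤ dualObj ℓ c α := by
  have hℓ : Continuous ℓ := continuousOn_univ.1 (hconv.continuousOn isOpen_univ)
  -- The slack variables are eliminated by setting them equal to the margins.
  obtain ⟨α, hα⟩ := exists_dual_certificate (v := v) convexOn_nuclearNorm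
    (marginMap (fun i => featureMatrix φ z (x i)) y) (convexOn_sum_loss hconv hc)
    (by fun_prop) (fun B => hv B _ fun i => le_rfl)
  have hN0 : nuclearNorm (0 : Fin p → H) = 0 :=
    le_antisymm (by simpa using nuclearNorm_smul_le le_rfl (0 : Fin p → H)) (nuclearNorm_nonneg _)
  have h0 : ∀ u : Fin n → ℝ, v ≤ c * ∑ i, ℓ (u i) + α ⬝ᵥ u := fun u => by
    simpa [hN0] using hα u 0
  refine ⟨α, ⟨?_, fun i => ?_⟩, coe_le_dualObj hc h0⟩
  · rw [dualMatrix_eq_transposeMul, lambdaMax_transposeMul_self_le_one_iff]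
    refine isContraction_of_trace_le_nuclearNorm fun B => sub_nonneg.1 ?_
    -- Ray `t B` at `u = 0`: were `‖B‖_* - Tr(Mᵀ B)` negative, the certificate would fail for large
    -- `t`.
    refine nonneg_of_forall_le_mul (C := v - c * ∑ _i : Fin n, ℓ 0) fun t ht => ?_
    have h₁ := hα 0 (t • B)
    rw [map_smul, dotProduct_smul, dotProduct_marginMap, dotProduct_zero, smul_eq_mul] at h₁
    have h₂ := nuclearNorm_smul_le ht B
    simp only [Pi.zero_apply] at h₁
    linarith
  -- Ray `u = t eᵢ` at `B = 0`: as `ℓ` is non-increasing, the loss stays below its value at `0`, so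
  -- `t αᵢ` is bounded below.
  · refine nonneg_of_forall_le_mul (C := v - c * ∑ _i : Fin n, ℓ 0) fun t ht => ?_
    have h₁ := h0 (Pi.single i t)
    rw [dotProduct_single] at h₁
    have h₂ : ∑ j, ℓ ((Pi.single i t : Fin n → ℝ) j) ≤ ∑ _j : Fin n, ℓ 0 :=
      Finset.sum_le_sum fun j _ => hmono (by
        rw [Pi.single_apply]; split_ifs <;> simp [ht])
    have h₃ := mul_le_mul_of_nonneg_left h₂ hc.le
    linarith

/-- Complementary slackness between a primal and a dual optimum. -/
theorem nuclearNorm_le_trace_of_optimal {φ : (Fin d₁ → ℝ) → H}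
    {z : Fin p → (Fin d₀ → ℝ) → (Fin d₁ → ℝ)} {x : Fin n → Fin d₀ → ℝ} {y : Fin n → ℝ}
    {ℓ : ℝ → ℝ} (hconv : ConvexOn ℝ Set.univ ℓ) (hmono : Antitone ℓ) {c : ℝ} (hc : 0 < c)
    {A : Fin p → H} (hA : IsPrimalOptimal φ z x y ℓ c A)
    {α : Fin n → ℝ} (hα : IsDualOptimal φ z x y ℓ c α) :
    nuclearNorm A ≤ (transposeMul (∑ i, (α i * y i) • featureMatrix φ z (x i)) A).trace := by
  obtain ⟨ξ, hξ, hopt⟩ := hA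
  obtain ⟨β, hβ, hvβ⟩ := exists_dualFeasible_coe_le_dualObj φ z x y hconv hmono hc hopt
  -- The dual value at `α` is at least the primal value. Evaluated at `u = ξ`, the losses cancel and
  -- leave `‖A‖_* ≤ α ⬝ᵥ ξ`.
  have h₁ := le_of_coe_le_dualObj hc (hvβ.trans (hα.2 β hβ)) ξ
  rw [primalObj, add_comm] at h₁
  refine (le_of_add_le_add_left h₁).trans ?_
  rw [← dotProduct_marginMap]
  exact Finset.sum_le_sum fun i _ => mul_le_mul_of_nonneg_left (hξ i) (hα.1.2 i)

end OptimalityConditions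

/-! ### Block identities for `[V₁ | V₂]` -/

section OrthogonalCompletion

variable {p r s : ℕ} {V₁ : Matrix (Fin p) (Fin r) ℝ} {V₂ : Matrix (Fin p) (Fin s) ℝ}

theorem IsOrthogonalCompletion.blocks (h : IsOrthogonalCompletion V₁ V₂) :
    V₁ᵀ * V₁ = 1 ∧ V₁ᵀ * V₂ = 0 ∧ V₂ᵀ * V₁ = 0 ∧ V₂ᵀ * V₂ = 1 ∧ V₁ * V₁ᵀ + V₂ * V₂ᵀ = 1 := by
  obtain ⟨h₁, h₂⟩ := h
  rw [Matrix.transpose_fromCols, Matrix.fromRows_mul_fromCols, ← Matrix.fromBlocks_one,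
    Matrix.fromBlocks_inj] at h₁
  rw [Matrix.transpose_fromCols, Matrix.fromCols_mul_fromRows] at h₂
  exact ⟨h₁.1, h₁.2.1, h₁.2.2.1, h₁.2.2.2, h₂⟩

theorem IsOrthogonalCompletion.card (h : IsOrthogonalCompletion V₁ V₂) : p = r + s := by
  simpa using Matrix.square_of_invertible _ _ h.2 h.1

end OrthogonalCompletion

/-! ### Fixed space and eigendecompositions of `V₁ V₁ᵀ + V₂ G V₂ᵀ` -/

section FixedSpace

variable {p r s : ℕ} {V₁ : Matrix (Fin p) (Fin r) ℝ} {V₂ : Matrix (Fin p) (Fin s) ℝ}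
  {S : Matrix (Fin p) (Fin p) ℝ} {G : Matrix (Fin s) (Fin s) ℝ}

/-- In the coordinates `V₁ᵀ X` and `V₂ᵀ X`, `S` acts as the identity and as `G`, and `G` fixes only
zero. The free column index serves single vectors, `V₁` itself and families of eigenvectors alike.
-/
theorem mul_eq_self_iff_of_completion (hV : IsOrthogonalCompletion V₁ V₂)
    (hS : S = V₁ * V₁ᵀ + V₂ * G * V₂ᵀ)
    {ι : Type*} (hG : ∀ Y : Matrix (Fin s) ι ℝ, G * Y = Y → Y = 0) (X : Matrix (Fin p) ι ℝ) :
    S * X = X ↔ X = V₁ * (V₁ᵀ * X) := by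
  obtain ⟨h₁₁, h₁₂, h₂₁, h₂₂, hsum⟩ := hV.blocks
  constructor
  · intro hX
    have h₁ : G * (V₂ᵀ * X) = V₂ᵀ * X := by
      conv_rhs => rw [← hX, hS, Matrix.add_mul, Matrix.mul_add, Matrix.mul_assoc V₁,
        ← Matrix.mul_assoc V₂ᵀ V₁, h₂₁, Matrix.zero_mul, zero_add, Matrix.mul_assoc V₂ G,
        Matrix.mul_assoc V₂, ← Matrix.mul_assoc V₂ᵀ V₂, h₂₂, Matrix.one_mul, Matrix.mul_assoc]
    calc X = (V₁ * V₁ᵀ + V₂ * V₂ᵀ) * X := by rw [hsum, Matrix.one_mul]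
      _ = V₁ * (V₁ᵀ * X) := by
        rw [Matrix.add_mul, Matrix.mul_assoc, Matrix.mul_assoc, hG _ h₁, Matrix.mul_zero, add_zero]
  · intro hX
    rw [hX, hS, Matrix.add_mul, Matrix.mul_assoc V₁, ← Matrix.mul_assoc V₁ᵀ V₁, h₁₁,
      Matrix.one_mul, Matrix.mul_assoc (V₂ * G), ← Matrix.mul_assoc V₂ᵀ V₁, h₂₁, Matrix.zero_mul,
      Matrix.mul_zero, add_zero]

theorem eigenspace_one_eq_span_col (h₁₁ : V₁ᵀ * V₁ = 1)
    (hfix : ∀ X : Matrix (Fin p) Unit ℝ, S * X = X ↔ X = V₁ * (V₁ᵀ * X)) :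
    Module.End.eigenspace (Matrix.toLin' S) 1 = Submodule.span ℝ (Set.range V₁.col) := by
  ext v
  rw [← Matrix.range_mulVecLin, Module.End.mem_eigenspace_iff, Matrix.toLin'_apply, one_smul,
    LinearMap.mem_range]
  have h := hfix (Matrix.replicateCol Unit v)
  simp only [← Matrix.replicateCol_mulVec, Matrix.replicateCol_inj] at h
  rw [h]
  constructor
  · intro hv
    exact ⟨V₁ᵀ *ᵥ v, hv.symm⟩
  · rintro ⟨w, rfl⟩
    rw [Matrix.mulVecLin_apply, Matrix.mulVec_mulVec _ V₁ᵀ, h₁₁, Matrix.one_mulVec]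

/-- The eigenvectors for the eigenvalue `1` in an arbitrary eigendecomposition. -/
theorem exists_submatrix_eq_mul_of_eigendecomposition (h₁₁ : V₁ᵀ * V₁ = 1)
    (hfix : ∀ {ι : Type} (X : Matrix (Fin p) ι ℝ), S * X = X ↔ X = V₁ * (V₁ᵀ * X))
    {V : Matrix (Fin p) (Fin p) ℝ} {lam : Fin p → ℝ} (hdet : IsUnit V.det)
    (hS : S = V * Matrix.diagonal lam * V⁻¹) :
    Nat.card {i : Fin p // lam i = 1} = r ∧
      ∀ e : Fin r ≃ {i : Fin p // lam i = 1},
        ∃ Q : Matrix (Fin r) (Fin r) ℝ, IsUnit Q.det ∧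
          V.submatrix id (fun k => (e k : Fin p)) = V₁ * Q ∧ (Vᵀ * V = 1 → Qᵀ * Q = 1) := by
  classical
  let I := {i : Fin p // lam i = 1}
  let VI : Matrix (Fin p) I ℝ := V.submatrix id Subtype.val
  -- `Q` and `R` express the selected eigenvectors and the columns of `V₁` through one another. They
  -- are two-sided inverses, which yields both the count of eigenvalues `1` and the invertibility.
  let Q : Matrix (Fin r) I ℝ := V₁ᵀ * VI
  let R : Matrix I (Fin r) ℝ := (V⁻¹ * V₁).submatrix Subtype.val id
  have hSV : S * V = V * Matrix.diagonal lam := by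
    rw [hS, Matrix.mul_assoc, Matrix.nonsing_inv_mul _ hdet, Matrix.mul_one]
  have hVI : VI = V₁ * Q := by
    refine (hfix VI).1 ?_
    ext i k
    have h := congrFun (congrFun hSV i) k.1
    rw [Matrix.mul_diagonal, k.2, mul_one] at h
    exact h
  have hSV₁ : S * V₁ = V₁ := (hfix V₁).2 (by rw [h₁₁, Matrix.mul_one])
  -- Hence the rows of `V⁻¹ V₁` with `λ ≠ 1` vanish, and only the eigenvectors for `1` contribute to
  -- `V₁`.
  have hΛ : Matrix.diagonal lam * (V⁻¹ * V₁) = V⁻¹ * V₁ := by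
    conv_rhs => rw [← hSV₁, hS, Matrix.mul_assoc, Matrix.mul_assoc, ← Matrix.mul_assoc V⁻¹ V,
      Matrix.nonsing_inv_mul _ hdet, Matrix.one_mul]
  have hV₁ : V₁ = VI * R := by
    have h : V₁ = V * (V⁻¹ * V₁) := by
      rw [← Matrix.mul_assoc, Matrix.mul_nonsing_inv _ hdet, Matrix.one_mul]
    ext i k
    conv_lhs => rw [h]
    rw [Matrix.mul_apply, Matrix.mul_apply,
      ← Fintype.sum_subtype_add_sum_subtype (fun i => lam i = 1)]
    refine add_eq_left.2 (Finset.sum_eq_zero fun j _ => ?_)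
    have h := congrFun (congrFun hΛ j) k
    rw [Matrix.diagonal_mul] at h
    have h₀ : (lam j - 1) * (V⁻¹ * V₁) j k = 0 := by rw [sub_mul, h, one_mul, sub_self]
    rw [(mul_eq_zero.1 h₀).resolve_left (sub_ne_zero.2 j.2), mul_zero]
  have hQR : Q * R = 1 := by
    calc Q * R = V₁ᵀ * (VI * R) := Matrix.mul_assoc _ _ _
      _ = 1 := by rw [← hV₁, h₁₁]
  have hVV : (V⁻¹).submatrix (Subtype.val : I → Fin p) id * VI = 1 := by
    have h := Matrix.nonsing_inv_mul _ hdet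
    ext i j
    have h2 := congrFun (congrFun h i.1) j.1
    rw [Matrix.one_apply] at h2 ⊢
    simp only [Subtype.ext_iff]
    exact h2
  have hRQ : R * Q = 1 := by
    calc R * Q = ((V⁻¹).submatrix (Subtype.val : I → Fin p) id * VI) * (R * Q) := by
          rw [hVV, Matrix.one_mul]
      _ = (V⁻¹).submatrix (Subtype.val : I → Fin p) id * ((VI * R) * Q) := by
          simp only [Matrix.mul_assoc]
      _ = 1 := by rw [← hV₁, ← hVI, hVV]
  refine ⟨?_, fun e => ⟨Q.submatrix id e, ?_, ?_, fun hV => ?_⟩⟩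
  · rw [Nat.card_eq_fintype_card]
    simpa using (Matrix.square_of_invertible _ _ hQR hRQ).symm
  · rw [← Matrix.isUnit_iff_isUnit_det]
    refine IsUnit.of_mul_eq_one (R.submatrix e id) ?_
    rw [Matrix.submatrix_mul_equiv, hQR]
    simp
  · ext i k
    exact congrFun (congrFun hVI i) (e k)
  · have h : VIᵀ * VI = 1 := by
      ext i j
      refine (congrFun (congrFun hV i.1) j.1).trans ?_
      rcases eq_or_ne i j with rfl | hij
      · rw [Matrix.one_apply_eq, Matrix.one_apply_eq]
      · rw [Matrix.one_apply_ne hij, Matrix.one_apply_ne (Subtype.coe_injective.ne hij)]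
    have hQQ : Qᵀ * Q = 1 := by
      rw [hVI, Matrix.transpose_mul, Matrix.mul_assoc, ← Matrix.mul_assoc V₁ᵀ, h₁₁,
        Matrix.one_mul] at h
      exact h
    ext i j
    have h2 := congrFun (congrFun hQQ (e i)) (e j)
    rw [Matrix.one_apply] at h2 ⊢
    simp only [e.injective.eq_iff] at h2
    exact h2

/-- An orthogonal eigendecomposition containing the columns of `V₁`. -/
theorem exists_eigendecomposition_extending (hV : IsOrthogonalCompletion V₁ V₂)
    (hS : S = V₁ * V₁ᵀ + V₂ * G * V₂ᵀ) {W : Matrix (Fin s) (Fin s) ℝ} {δ : Fin s → ℝ}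
    (hW : Wᵀ * W = 1) (hG : G = W * Matrix.diagonal δ * Wᵀ) (hδ : ∀ k, δ k ≠ 1) :
    ∃ (V : Matrix (Fin p) (Fin p) ℝ) (lam : Fin p → ℝ) (e : Fin r ≃ {i : Fin p // lam i = 1}),
      Vᵀ * V = 1 ∧ S = V * Matrix.diagonal lam * V⁻¹ ∧
        V.submatrix id (fun k => (e k : Fin p)) = V₁ := by
  obtain ⟨h₁₁, h₁₂, h₂₁, h₂₂, -⟩ := hV.blocks
  let σ : Fin p ≃ Fin r ⊕ Fin s := (finCongr hV.card).trans finSumFinEquiv.symm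
  -- Rotating `V₂` by `W` diagonalizes the second block without touching `V₁`.
  let B : Matrix (Fin p) (Fin r ⊕ Fin s) ℝ := Matrix.fromCols V₁ (V₂ * W)
  let D : Fin r ⊕ Fin s → ℝ := Sum.elim (fun _ => 1) δ
  have hB : Bᵀ * B = 1 := by
    have h₁ : V₁ᵀ * (V₂ * W) = 0 := by rw [← Matrix.mul_assoc, h₁₂, Matrix.zero_mul]
    have h₂ : Wᵀ * V₂ᵀ * V₁ = 0 := by rw [Matrix.mul_assoc, h₂₁, Matrix.mul_zero]
    have h₃ : Wᵀ * V₂ᵀ * (V₂ * W) = 1 := by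
      rw [Matrix.mul_assoc, ← Matrix.mul_assoc V₂ᵀ, h₂₂, Matrix.one_mul, hW]
    rw [Matrix.transpose_fromCols, Matrix.fromRows_mul_fromCols, Matrix.transpose_mul, h₁₁, h₁, h₂,
      h₃, Matrix.fromBlocks_one]
  have hSB : S = B * Matrix.diagonal D * Bᵀ := by
    have h : B * Matrix.diagonal D = Matrix.fromCols V₁ (V₂ * W * Matrix.diagonal δ) := by
      ext i (k | k)
      · simp [B, D, Matrix.mul_diagonal]
      · simp only [B, D, Matrix.mul_diagonal, Matrix.fromCols_apply_inr, Sum.elim_inr]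
    rw [h, Matrix.transpose_fromCols, Matrix.fromCols_mul_fromRows, hS, hG, Matrix.transpose_mul]
    simp only [Matrix.mul_assoc]
  have hVV : (B.submatrix id σ)ᵀ * B.submatrix id σ = 1 := by
    ext i j
    have h2 := congrFun (congrFun hB (σ i)) (σ j)
    rw [Matrix.one_apply] at h2 ⊢
    simp only [σ.injective.eq_iff] at h2
    exact h2
  have he : ∀ k, (D ∘ σ) (σ.symm (Sum.inl k)) = 1 := fun k => by simp [D]
  refine ⟨B.submatrix id σ, D ∘ σ, Equiv.ofBijective
    (fun k => ⟨σ.symm (Sum.inl k), he k⟩) ⟨fun k l h => ?_, fun i => ?_⟩, hVV, ?_, ?_⟩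
  · simpa using h
  · obtain ⟨i, hi⟩ := i
    obtain ⟨j, rfl⟩ := σ.symm.surjective i
    rcases j with k | k
    · exact ⟨k, rfl⟩
    · simp only [Function.comp_apply, Equiv.apply_symm_apply, D, Sum.elim_inr] at hi
      exact absurd hi (hδ k)
  · rw [Matrix.inv_eq_left_inv hVV, hSB]
    ext i j
    rw [Matrix.mul_apply, Matrix.mul_apply, ← σ.sum_comp]
    refine Finset.sum_congr rfl fun k _ => ?_
    rw [Matrix.mul_diagonal, Matrix.mul_diagonal]
    rfl
  · ext i k
    change Matrix.fromCols V₁ (V₂ * W) i (σ (σ.symm (Sum.inl k))) = V₁ i k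
    rw [Equiv.apply_symm_apply, Matrix.fromCols_apply_inl]

end FixedSpace

/-! ### Contractions attaining the nuclear norm and their block structure -/

section SpectralStructure

variable {H : Type*} [NormedAddCommGroup H] [InnerProductSpace ℝ H] {p r s : ℕ}

/-- Testing `A` against the contraction `U₁ V₁ᵀ` gives this half of `‖A‖_* = ∑ d_k`, the only half
needed, without matching the `d_k` with the eigenvalues of `Aᵀ A`. -/
theorem sum_le_nuclearNorm_of_isCompactSVD {A : Fin p → H} {U₁ : Fin r → H} {d : Fin r → ℝ}
    {V₁ : Matrix (Fin p) (Fin r) ℝ} (hSVD : IsCompactSVD A U₁ d V₁)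
    {V₂ : Matrix (Fin p) (Fin s) ℝ} (hV : IsOrthogonalCompletion V₁ V₂) :
    ∑ k, d k ≤ nuclearNorm A := by
  have hc : IsContraction (colMul U₁ V₁ᵀ) := fun v => by
    have h : v ⬝ᵥ v = v ⬝ᵥ ((V₁ * V₁ᵀ + V₂ * V₂ᵀ) *ᵥ v) := by
      rw [hV.blocks.2.2.2.2, Matrix.one_mulVec]
    have h₂ : 0 ≤ v ⬝ᵥ ((V₂ * V₂ᵀ) *ᵥ v) := by
      rw [← Matrix.mulVec_mulVec, Matrix.dotProduct_mulVec, ← Matrix.mulVec_transpose]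
      exact Finset.sum_nonneg fun i _ => mul_self_nonneg _
    rw [norm_sq_colMulVec, transposeMul_colMul, hSVD.orthonormal_left, Matrix.transpose_transpose,
      Matrix.mul_one, h, Matrix.add_mulVec, dotProduct_add]
    linarith
  have h := hc.trace_le_nuclearNorm A
  rw [hSVD.eq, transposeMul_colMul, hSVD.orthonormal_left, Matrix.transpose_transpose,
    Matrix.mul_one, ← Matrix.mul_assoc, Matrix.trace_mul_comm, ← Matrix.mul_assoc,
    hSVD.orthonormal_right, Matrix.one_mul, Matrix.trace_diagonal, ← hSVD.eq] at h
  exact h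

/-- A contraction that attains the nuclear norm of `A` maps right to left singular vectors. -/
theorem IsContraction.colMul_right_eq_left {M A : Fin p → H} (hM : IsContraction M)
    {U₁ : Fin r → H} {d : Fin r → ℝ} {V₁ : Matrix (Fin p) (Fin r) ℝ}
    (hSVD : IsCompactSVD A U₁ d V₁) (h : ∑ k, d k ≤ (transposeMul M A).trace) :
    _root_.colMul M V₁ = U₁ := by
  have hc := hM.colMul hSVD.orthonormal_right
  set X := _root_.colMul M V₁ with hX
  have hU : ∀ k, ‖U₁ k‖ = 1 := fun k => by
    have h₁ := congrFun (congrFun hSVD.orthonormal_left k) k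
    rw [transposeMul, Matrix.of_apply, real_inner_self_eq_norm_sq, Matrix.one_apply_eq] at h₁
    exact (pow_eq_one_iff_of_nonneg (norm_nonneg _) two_ne_zero).1 h₁
  have htr : (transposeMul M A).trace = ∑ k, d k * ⟪X k, U₁ k⟫_ℝ := by
    rw [hSVD.eq, transposeMul_colMul_right, ← Matrix.mul_assoc, Matrix.trace_mul_comm,
      ← Matrix.mul_assoc, ← transposeMul_colMul_left, ← hX, Matrix.trace]
    refine Finset.sum_congr rfl fun k _ => ?_
    rw [Matrix.diag_apply, Matrix.mul_diagonal, mul_comm]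
    rfl
  have hle : ∀ k, ⟪X k, U₁ k⟫_ℝ ≤ 1 := fun k => by
    refine (real_inner_le_norm _ _).trans ?_
    rw [hU, mul_one]
    exact hc.norm_apply_le k
  have heq : ∀ k, d k * ⟪X k, U₁ k⟫_ℝ = d k := by
    have h₁ : ∀ k ∈ Finset.univ, d k * ⟪X k, U₁ k⟫_ℝ ≤ d k := fun k _ => by
      nlinarith [hle k, hSVD.pos k]
    -- Termwise upper bounds with equal sums force termwise equality; positivity of `d k` then gives
    -- inner product `1`.
    exact fun k => (Finset.sum_eq_sum_iff_of_le h₁).1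
      (le_antisymm (Finset.sum_le_sum h₁) (htr ▸ h)) k (Finset.mem_univ k)
  funext k
  have h₁ : ⟪X k, U₁ k⟫_ℝ = 1 := mul_left_cancel₀ (hSVD.pos k).ne' (by rw [heq, mul_one])
  have h₂ := norm_sub_sq_real (X k) (U₁ k)
  rw [h₁, hU] at h₂
  have h₃ := hc.norm_apply_le k
  have h₄ : ‖X k - U₁ k‖ ^ 2 ≤ 0 := by nlinarith [norm_nonneg (X k)]
  rw [← sub_eq_zero, ← norm_eq_zero]
  exact pow_eq_zero_iff two_ne_zero |>.1 (le_antisymm h₄ (sq_nonneg _))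

/-- A contraction that is isometric on the columns of `V₁` preserves orthogonality to them. -/
theorem IsContraction.transposeMul_eq_zero {M : Fin p → H} (hM : IsContraction M)
    {U₁ : Fin r → H} (hU : transposeMul U₁ U₁ = 1) {V₁ : Matrix (Fin p) (Fin r) ℝ}
    {V₂ : Matrix (Fin p) (Fin s) ℝ} (hV : IsOrthogonalCompletion V₁ V₂)
    (hMV : _root_.colMul M V₁ = U₁) : transposeMul U₁ (_root_.colMul M V₂) = 0 := by
  obtain ⟨h₁₁, h₁₂, -, h₂₂, -⟩ := hV.blocks
  ext k j
  set a := transposeMul U₁ (_root_.colMul M V₂) k j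
  -- With `a` the inner product to be killed, the image has squared norm at least `1 + 2a²`, while
  -- the vector itself has `1 + a²`.
  have h := hM (V₁.col k + a • V₂.col j)
  rw [colMulVec_add, colMulVec_smul, ← colMul_apply, ← colMul_apply, hMV, norm_add_sq_real,
    inner_smul_right, dotProduct_add, add_dotProduct, add_dotProduct, dotProduct_smul,
    dotProduct_smul, smul_dotProduct, smul_dotProduct, dotProduct_comm (V₂.col j) (V₁.col k)] at h
  have h₁ : V₁.col k ⬝ᵥ V₂.col j = 0 := congrFun (congrFun h₁₂ k) j
  have h₁' : V₁.col k ⬝ᵥ V₁.col k = 1 :=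
    (congrFun (congrFun h₁₁ k) k).trans (Matrix.one_apply_eq k)
  have h₂' : V₂.col j ⬝ᵥ V₂.col j = 1 :=
    (congrFun (congrFun h₂₂ j) j).trans (Matrix.one_apply_eq j)
  have h₂ : ‖U₁ k‖ ^ 2 = 1 := by
    rw [← real_inner_self_eq_norm_sq]
    exact (congrFun (congrFun hU k) k).trans (Matrix.one_apply_eq k)
  have h₃ : ⟪U₁ k, _root_.colMul M V₂ j⟫_ℝ = a := rfl
  rw [h₁, h₂, h₃, h₁', h₂'] at h
  simp only [smul_eq_mul] at h
  rw [Matrix.zero_apply]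
  nlinarith [sq_nonneg ‖a • _root_.colMul M V₂ j‖, sq_nonneg a]

theorem mem_orthogonal_span_range {U₁ : Fin r → H} {w : H} (h : ∀ k, ⟪U₁ k, w⟫_ℝ = 0) :
    w ∈ (Submodule.span ℝ (Set.range U₁))ᗮ := by
  rw [Submodule.mem_orthogonal]
  intro u hu
  induction hu using Submodule.span_induction with
  | mem u hu => obtain ⟨k, rfl⟩ := hu; exact h k
  | zero => exact inner_zero_left _
  | add u v _ _ hu hv => rw [inner_add_left, hu, hv, add_zero]
  | smul t u _ hu => rw [inner_smul_left, hu, mul_zero]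

theorem transposeMul_complMul (U₁ : Fin r → H)
    (E : Fin s → (Submodule.span ℝ (Set.range U₁))ᗮ) : transposeMul U₁ (complMul U₁ E) = 0 := by
  ext k j
  exact (Submodule.mem_orthogonal _ _).1 (E j).2 _ (Submodule.subset_span ⟨k, rfl⟩)

theorem IsContraction.singVal_le_one {M : Fin p → H} (hM : IsContraction M) (k : Fin p) :
    singVal M k ≤ 1 := by
  obtain ⟨W, h₁, -, -, h₄⟩ := exists_right_singular_vectors M
  rw [← h₄, ← colMul_apply]
  exact (hM.colMul h₁).norm_apply_le k

theorem singVal_le_sigmaMax (M : Fin p → H) (k : Fin p) : singVal M k ≤ sigmaMax M :=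
  le_ciSup (Set.finite_range _).bddAbove k

/-- If `M` is a contraction which maps `V₁` to `U₁`, then `M` is block diagonal with respect to the
orthogonal decompositions given by `V₁` and `U₁`. -/
theorem IsContraction.existsUnique_block {M : Fin p → H} (hM : IsContraction M)
    {U₁ : Fin r → H} (hU : transposeMul U₁ U₁ = 1) {V₁ : Matrix (Fin p) (Fin r) ℝ}
    {V₂ : Matrix (Fin p) (Fin s) ℝ} (hV : IsOrthogonalCompletion V₁ V₂)
    (hMV : _root_.colMul M V₁ = U₁) :
    ∃! E : Fin s → (Submodule.span ℝ (Set.range U₁))ᗮ,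
      M = _root_.colMul U₁ V₁ᵀ + _root_.colMul (complMul U₁ E) V₂ᵀ := by
  obtain ⟨-, h₁₂, -, h₂₂, hsum⟩ := hV.blocks
  have horth := hM.transposeMul_eq_zero hU hV hMV
  refine ⟨fun j => ⟨_root_.colMul M V₂ j, mem_orthogonal_span_range fun k =>
    congrFun (congrFun horth k) j⟩, ?_, fun E hE => ?_⟩
  · change M = _root_.colMul U₁ V₁ᵀ + _root_.colMul (_root_.colMul M V₂) V₂ᵀ
    rw [← hMV, colMul_colMul, colMul_colMul, ← colMul_add, hsum, colMul_one]
  · funext j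
    apply Subtype.ext
    -- Right multiplication by `V₂` annihilates `U₁ V₁ᵀ` and isolates `E`.
    have h := congrArg (fun X => _root_.colMul X V₂) hE
    simp only [add_colMul, colMul_colMul, h₁₂, h₂₂, colMul_zero, colMul_one, zero_add] at h
    exact (congrFun h j).symm

/-- The blocks of the Gram matrix. -/
theorem transposeMul_self_of_block {M : Fin p → H} {U₁ : Fin r → H} (hU : transposeMul U₁ U₁ = 1)
    {V₁ : Matrix (Fin p) (Fin r) ℝ} {V₂ : Matrix (Fin p) (Fin s) ℝ}
    {E : Fin s → (Submodule.span ℝ (Set.range U₁))ᗮ}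
    (hE : M = colMul U₁ V₁ᵀ + colMul (complMul U₁ E) V₂ᵀ) :
    transposeMul M M = V₁ * V₁ᵀ + V₂ * transposeMul E E * V₂ᵀ := by
  have h₁ := transposeMul_complMul U₁ E
  have h₂ : transposeMul (complMul U₁ E) U₁ = 0 := by
    rw [← transpose_transposeMul, h₁, Matrix.transpose_zero]
  have h₃ : transposeMul (complMul U₁ E) (complMul U₁ E) = transposeMul E E := rfl
  rw [hE, transposeMul_add_left, transposeMul_add_right, transposeMul_add_right,
    transposeMul_colMul, transposeMul_colMul, transposeMul_colMul, transposeMul_colMul, hU, h₁, h₂,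
    h₃]
  simp

theorem IsContraction.of_block {M : Fin p → H} (hM : IsContraction M) {U₁ : Fin r → H}
    {V₁ : Matrix (Fin p) (Fin r) ℝ} {V₂ : Matrix (Fin p) (Fin s) ℝ}
    (hV : IsOrthogonalCompletion V₁ V₂) {E : Fin s → (Submodule.span ℝ (Set.range U₁))ᗮ}
    (hE : M = _root_.colMul U₁ V₁ᵀ + _root_.colMul (complMul U₁ E) V₂ᵀ) : IsContraction E := by
  obtain ⟨-, h₁₂, -, h₂₂, -⟩ := hV.blocks
  have h := congrArg (fun X => _root_.colMul X V₂) hE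
  simp only [add_colMul, colMul_colMul, h₁₂, h₂₂, colMul_zero, colMul_one, zero_add] at h
  have hc := hM.colMul h₂₂
  rw [h] at hc
  intro v
  rw [norm_sq_colMulVec]
  have := hc v
  rw [norm_sq_colMulVec] at this
  exact this

/-- The eigenvalues of `Eᵀ E` are the squared singular values, all below `1`, so `1` is not among
them. -/
theorem eq_zero_of_gram_mul_eq_self {E : Fin s → H} (hσ : sigmaMax E < 1) {ι : Type*}
    (Y : Matrix (Fin s) ι ℝ) (hY : transposeMul E E * Y = Y) : Y = 0 := by
  obtain ⟨W, h₁, h₂, h₃, -⟩ := exists_right_singular_vectors E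
  have hD : Matrix.diagonal (fun k => singVal E k ^ 2) * (Wᵀ * Y) = Wᵀ * Y := by
    conv_rhs => rw [← hY, h₃, Matrix.mul_assoc, Matrix.mul_assoc, ← Matrix.mul_assoc Wᵀ W, h₁,
      Matrix.one_mul]
  have hZ : Wᵀ * Y = 0 := by
    ext k j
    have h := congrFun (congrFun hD k) j
    rw [Matrix.diagonal_mul] at h
    have h₄ : singVal E k ^ 2 < 1 := by
      have := (singVal_le_sigmaMax E k).trans_lt hσ
      nlinarith [singVal_nonneg E k]
    rw [Matrix.zero_apply]
    have h₅ : (1 - singVal E k ^ 2) * (Wᵀ * Y) k j = 0 := by linarith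
    exact (mul_eq_zero.1 h₅).resolve_left (by linarith)
  rw [← Matrix.one_mul Y, ← h₂, Matrix.mul_assoc, hZ, Matrix.mul_zero]

end SpectralStructure

/-! ### The main theorem -/

theorem theorem2 {H : Type*} [NormedAddCommGroup H] [InnerProductSpace ℝ H] [CompleteSpace H]
    {d₀ d₁ p n r s : ℕ}
    (φ : (Fin d₁ → ℝ) → H) (z : Fin p → (Fin d₀ → ℝ) → (Fin d₁ → ℝ))
    (x : Fin n → Fin d₀ → ℝ) (y : Fin n → ℝ)
    (ℓ : ℝ → ℝ) (hconv : ConvexOn ℝ Set.univ ℓ) (hmono : Antitone ℓ)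
    (c : ℝ) (hc : 0 < c)
    (A : Fin p → H) (hA : IsPrimalOptimal φ z x y ℓ c A)
    (α : Fin n → ℝ) (hα : IsDualOptimal φ z x y ℓ c α)
    (U₁ : Fin r → H) (d : Fin r → ℝ) (V₁ : Matrix (Fin p) (Fin r) ℝ)
    (hSVD : IsCompactSVD A U₁ d V₁)
    (V₂ : Matrix (Fin p) (Fin s) ℝ) (hV₂ : IsOrthogonalCompletion V₁ V₂)
    (S : Matrix (Fin p) (Fin p) ℝ) (hS : S = dualMatrix φ z x y α) :
    (∃! E : Fin s → (Submodule.span ℝ (Set.range U₁))ᗮ,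
      ∑ i, (α i * y i) • featureMatrix φ z (x i)
        = colMul U₁ V₁ᵀ + colMul (complMul U₁ E) V₂ᵀ) ∧
    ∀ E : Fin s → (Submodule.span ℝ (Set.range U₁))ᗮ,
      ∑ i, (α i * y i) • featureMatrix φ z (x i)
        = colMul U₁ V₁ᵀ + colMul (complMul U₁ E) V₂ᵀ →
      sigmaMax E ≤ 1 ∧
      S = V₁ * V₁ᵀ + V₂ * transposeMul E E * V₂ᵀ ∧
      S * V₁ = V₁ ∧
      (sigmaMax E < 1 →
        Module.End.eigenspace (Matrix.toLin' S) 1 = Submodule.span ℝ (Set.range V₁.col) ∧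
        (∀ (V : Matrix (Fin p) (Fin p) ℝ) (lam : Fin p → ℝ), IsUnit V.det →
          S = V * Matrix.diagonal lam * V⁻¹ →
          Nat.card {i : Fin p // lam i = 1} = r ∧
          ∀ e : Fin r ≃ {i : Fin p // lam i = 1},
            ∃ Q : Matrix (Fin r) (Fin r) ℝ, IsUnit Q.det ∧
              V.submatrix id (fun k => (e k : Fin p)) = V₁ * Q ∧
              (Vᵀ * V = 1 → Qᵀ * Q = 1)) ∧
        (∃ (V : Matrix (Fin p) (Fin p) ℝ) (lam : Fin p → ℝ)
            (e : Fin r ≃ {i : Fin p // lam i = 1}),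
          Vᵀ * V = 1 ∧ S = V * Matrix.diagonal lam * V⁻¹ ∧
          V.submatrix id (fun k => (e k : Fin p)) = V₁)) := by
  set M := ∑ i, (α i * y i) • featureMatrix φ z (x i) with hM
  have hSM : S = transposeMul M M := by rw [hS, dualMatrix_eq_transposeMul]
  have hcM : IsContraction M := by
    rw [← lambdaMax_transposeMul_self_le_one_iff, ← dualMatrix_eq_transposeMul]
    exact hα.1.1
  -- The chain `∑ d_k ≤ ‖A‖_* ≤ Tr(Mᵀ A)` puts `M` in the equality case.
  have hMV : colMul M V₁ = U₁ := hcM.colMul_right_eq_left hSVD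
    ((sum_le_nuclearNorm_of_isCompactSVD hSVD hV₂).trans
      (nuclearNorm_le_trace_of_optimal hconv hmono hc hA hα))
  refine ⟨hcM.existsUnique_block hSVD.orthonormal_left hV₂ hMV, fun E hE => ?_⟩
  have hblock : S = V₁ * V₁ᵀ + V₂ * transposeMul E E * V₂ᵀ := by
    rw [hSM]
    exact transposeMul_self_of_block hSVD.orthonormal_left hE
  obtain ⟨h₁₁, -, h₂₁, -, -⟩ := hV₂.blocks
  refine ⟨Real.iSup_le (hcM.of_block hV₂ hE).singVal_le_one zero_le_one, hblock, ?_, fun hσ => ?_⟩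
  · rw [hblock, Matrix.add_mul, Matrix.mul_assoc V₁, h₁₁, Matrix.mul_one, Matrix.mul_assoc _ V₂ᵀ,
      h₂₁, Matrix.mul_zero, add_zero]
  · have hfix : ∀ {ι : Type} (X : Matrix (Fin p) ι ℝ), S * X = X ↔ X = V₁ * (V₁ᵀ * X) :=
      fun X => mul_eq_self_iff_of_completion hV₂ hblock (eq_zero_of_gram_mul_eq_self hσ) X
    obtain ⟨W, hW, -, hG, -⟩ := exists_right_singular_vectors E
    refine ⟨eigenspace_one_eq_span_col h₁₁ hfix,
      fun V lam hdet hdec => exists_submatrix_eq_mul_of_eigendecomposition h₁₁ hfix hdet hdec,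
      exists_eigendecomposition_extending hV₂ hblock hW hG fun k => ?_⟩
    have hk := (singVal_le_sigmaMax E k).trans_lt hσ
    nlinarith [singVal_nonneg E k]
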